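/- **Theorem 1.** Let $M,N_a,\tau_c,T\ge 1$ and $K\ge 0$ be integers, let $L$ be a real number, and let $0<\epsilon\le 1$ and $\delta>0$. There are $M$ access points (APs). The data of AP $m$ are a set $\Omega_m\subseteq\{1,\dots,N_a\}\times\{1,\dots,\tau_c\}$ of observed positions and a matrix $\mathbf Y_m\in\mathbb C^{N_a\times\tau_c}$; they are *possible* if $\mathbf Y_m$ vanishes outside $\Omega_m$ and $\|\mathbf Y_m\|_{\mathcal F}\le L$. For a matrix $\mathbf A$, $(\mathbf A)_{\Omega}$ denotes $\mathbf A$ with the entries outside $\Omega$ set to zero, and $\Xi_{L,\Omega}(\mathbf A)=\min\{L/\|(\mathbf A)_\Omega\|_{\mathcal F},1\}\,\mathbf A$ (the minimum being $1$ if $(\mathbf A)_\Omega=0$). Put $$\mu=\frac{16L^2}{\epsilon}\sqrt{\frac TM\ln\Big(\frac{2.5\,T}{\delta}\Big)\ln\Big(\frac2\delta\Big)}$$ (the square root being read as $0$ if its argument is negative, which can occur only for $\delta>2$). Consider the following randomized algorithm (Frank–Wolfe-based privacy-preserving matrix completion). Set $\mathbf X_m^{(0)}=\mathbf 0$ for all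 $m$, $\eta^{(1)}=1$ and $\eta^{(n)}=1/T$ for $2\le n\le T$. For $n=1,\dots,T$: 1. Each AP $m$ computes $\mathbf J_m^{(n-1)}=(\mathbf X_m^{(n-1)})_{\Omega_m}-\mathbf Y_m$ and sends $(\mathbf J_m^{(n-1)})^{\rm H}\mathbf J_m^{(n-1)}+\mathbf G_m^{(n-1)}$ to the central processing unit (CPU). Here $\mathbf G_m^{(n-1)}$ is a Hermitian $\tau_c\times\tau_c$ noise matrix whose entries on and above the diagonal are independent, $\mathcal N(0,\mu^2)$ on the diagonal and circularly symmetric complex Gaussian $\mathcal N_c(0,\mu^2)$ above it (real and imaginary parts independent $\mathcal N(0,\mu^2/2)$); the noise matrices are independent over all APs and iterations. 2. The CPU forms the sum $\widehat{\mathbb W}^{(n-1)}$ of the received matrices and computes a unit eigenvector $\widehat{\mathbf v}^{(n)}$ for its largest eigenvalue and the square root $\widehat\lambda^{(n)}$ of this eigenvalue, by some fixed measurable rule. (The choice of the eigenvector, and of a real value of $\widehat\lambda^{(n)}$ when the largest eigenvalue is negative, is left to the rule.) It broadcasts $\widehat{\mathbf v}^{(n)}$ and $\widetilde\lambda^{(n)}=\widehat\lambda^{(n)}+\sqrt\mu\,(M\tau_c)^{1/4}$.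 3. Each AP $m$ sets (with the quotient read as $0$ if $\widetilde\lambda^{(n)}=0$) $$\mathbf X_m^{(n)}=\Xi_{L,\Omega_m}\Big((1-\eta^{(n)})\mathbf X_m^{(n-1)}-\frac{\eta^{(n)}K}{\widetilde\lambda^{(n)}}\,\mathbf J_m^{(n-1)}\widehat{\mathbf v}^{(n)}(\widehat{\mathbf v}^{(n)})^{\rm H}\Big).$$ The output is $\widehat{\mathbf X}_m=\mathbf X_m^{(T)}$ for each AP $m$. For every such rule of the CPU, this algorithm is $(\epsilon,\delta)$-joint differentially private: for every AP $m$, any two families of possible data $\mathbf Y,\mathbf Y'$ of the $M$ APs that agree at all APs other than $m$, and every measurable set $S\subseteq(\mathbb C^{N_a\times\tau_c})^{M-1}$, $$P\big[(\widehat{\mathbf X}_j(\mathbf Y))_{j\ne m}\in S\big]\le e^{\epsilon}\,P\big[(\widehat{\mathbf X}_j(\mathbf Y'))_{j\ne m}\in S\big]+\delta ,$$ where the probability is over the noise matrices. -/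

import Mathlib

open MeasureTheory ProbabilityTheory
open scoped Matrix

namespace PrivateFW

noncomputable section

/-- The Borel (entrywise product) σ-algebra on complex matrices. -/
instance instMeasurableSpaceMatrix {a b : ℕ} : MeasurableSpace (Matrix (Fin a) (Fin b) ℂ) :=
  inferInstanceAs (MeasurableSpace (Fin a → Fin b → ℂ))

/-- The Frobenius norm of a complex matrix. -/
def frobNorm {a b : ℕ} (A : Matrix (Fin a) (Fin b) ℂ) : ℝ :=
  Real.sqrt (∑ i, ∑ j, ‖A i j‖ ^ 2)

/-- `(A)_Ω`: the entries of `A` outside the index set `Ω` are replaced by zero. -/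
def restrictTo {a b : ℕ} (Ω : Finset (Fin a × Fin b)) (A : Matrix (Fin a) (Fin b) ℂ) :
    Matrix (Fin a) (Fin b) ℂ :=
  Matrix.of fun i j => if (i, j) ∈ Ω then A i j else 0

/-- The data of one access point: the set `Ω_m` of observed (antenna, time slot) pairs and the
sampled received signal `Y_m`. -/
structure LocalData (Na τ : ℕ) where
  mask : Finset (Fin Na × Fin τ)
  signal : Matrix (Fin Na) (Fin τ) ℂ

/-- The possible values of the data of an access point: `Y_m` vanishes outside `Ω_m` and
`‖Y_m‖_F ≤ L`. -/
def LocalData.IsPossible {Na τ : ℕ} (L : ℝ) (d : LocalData Na τ) : Prop :=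
  (∀ i t, (i, t) ∉ d.mask → d.signal i t = 0) ∧ frobNorm d.signal ≤ L

/-- `(ε, δ)`-joint differential privacy of a randomized algorithm `A` that receives one datum in
`D` from each of `M` parties and returns one output in `Q` to each of them; `P` is the law of the
internal randomness `ω : R`, and `possible` is the set of possible values of a party's datum. -/
def IsJointDP {M : ℕ} {D Q R : Type*} [MeasurableSpace Q] [MeasurableSpace R]
    (P : Measure R) (A : (Fin M → D) → R → Fin M → Q) (possible : D → Prop) (ε δ : ℝ) : Prop :=
  ∀ (m : Fin M) (Y Y' : Fin M → D), (∀ j, possible (Y j)) → (∀ j, possible (Y' j)) →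
    (∀ j, j ≠ m → Y j = Y' j) →
    ∀ S : Set ({j : Fin M // j ≠ m} → Q), MeasurableSet S →
      P {ω | (fun j : {j : Fin M // j ≠ m} => A Y ω j) ∈ S} ≤
        ENNReal.ofReal (Real.exp ε) * P {ω | (fun j : {j : Fin M // j ≠ m} => A Y' ω j) ∈ S}
          + ENNReal.ofReal δ

/-- The calibrated noise level `μ` (a standard deviation). -/
def noiseLevel (M T : ℕ) (L ε δ : ℝ) : ℝ :=
  16 * L ^ 2 * Real.sqrt ((T : ℝ) / M * Real.log (2.5 * T / δ) * Real.log (2 / δ)) / ε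

/-- The Hermitian matrix with diagonal entries `g i i`, entries `g i j + √-1 g j i` above the
diagonal, and their complex conjugates below the diagonal. -/
def hermitianOf {τ : ℕ} (g : Fin τ → Fin τ → ℝ) : Matrix (Fin τ) (Fin τ) ℂ :=
  Matrix.of fun i j =>
    if i = j then (g i i : ℂ)
    else if i < j then (g i j : ℂ) + (g j i : ℂ) * Complex.I
    else (g j i : ℂ) - (g i j : ℂ) * Complex.I

/-- The law of a Hermitian noise matrix with independent entries on and above the diagonal:
`N(0, μ²)` on the diagonal, and circularly symmetric complex `N_c(0, μ²)` above it (real and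
imaginary parts independent, each `N(0, μ²/2)`). -/
def hermitianNoise (τ : ℕ) (μ : ℝ) : Measure (Matrix (Fin τ) (Fin τ) ℂ) :=
  (Measure.pi fun i : Fin τ => Measure.pi fun j : Fin τ =>
    gaussianReal 0 (if i = j then (μ ^ 2).toNNReal else (μ ^ 2 / 2).toNNReal)).map hermitianOf

/-- The law of all noise matrices: independent over the `T` iterations and the `M` access
points. -/
def noiseLaw (T M τ : ℕ) (μ : ℝ) : Measure (Fin T → Fin M → Matrix (Fin τ) (Fin τ) ℂ) :=
  Measure.pi fun _ : Fin T => Measure.pi fun _ : Fin M => hermitianNoise τ μ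

/-- `lam` is the largest eigenvalue of `W`, and `v` is a unit eigenvector for it. -/
def IsLargestEigenpair {τ : ℕ} (W : Matrix (Fin τ) (Fin τ) ℂ) (lam : ℝ) (v : Fin τ → ℂ) : Prop :=
  star v ⬝ᵥ v = 1 ∧ W *ᵥ v = (lam : ℂ) • v ∧
    ∀ (x : ℝ) (u : Fin τ → ℂ), u ≠ 0 → W *ᵥ u = (x : ℂ) • u → x ≤ lam

/-- A rule by which the CPU computes `(lamHat, v)` from a Hermitian matrix `W`: `v` is a unit
eigenvector for the largest eigenvalue of `W`, and `lamHat` is the square root of that eigenvalue.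
Which eigenvector is taken, and which real number serves as `lamHat` when the largest eigenvalue
is negative, is left to the rule. -/
def IsTopEigenRule {τ : ℕ} (cpu : Matrix (Fin τ) (Fin τ) ℂ → ℝ × (Fin τ → ℂ)) : Prop :=
  ∀ W : Matrix (Fin τ) (Fin τ) ℂ, W.IsHermitian →
    ∃ lam : ℝ, IsLargestEigenpair W lam (cpu W).2 ∧ (0 ≤ lam → (cpu W).1 = Real.sqrt lam)

/-- `Ξ_{L,Ω}(A) = min {L / ‖(A)_Ω‖_F, 1} A`, where the minimum is `1` if `(A)_Ω = 0`. -/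
def clip {a b : ℕ} (L : ℝ) (Ω : Finset (Fin a × Fin b)) (A : Matrix (Fin a) (Fin b) ℂ) :
    Matrix (Fin a) (Fin b) ℂ :=
  if frobNorm (restrictTo Ω A) ≤ L then A
  else ((L / frobNorm (restrictTo Ω A) : ℝ) : ℂ) • A

/-- The residual `J_m = (X_m)_{Ω_m} - Y_m`. -/
def residual {Na τ : ℕ} (d : LocalData Na τ) (X : Matrix (Fin Na) (Fin τ) ℂ) :
    Matrix (Fin Na) (Fin τ) ℂ :=
  restrictTo d.mask X - d.signal

/-- What access point `m` sends to the CPU: `J_mᴴ J_m + G_m`. -/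
def noisyGram {Na τ : ℕ} (d : LocalData Na τ) (X : Matrix (Fin Na) (Fin τ) ℂ)
    (G : Matrix (Fin τ) (Fin τ) ℂ) : Matrix (Fin τ) (Fin τ) ℂ :=
  (residual d X)ᴴ * residual d X + G

/-- The update of an access point, from its data, its iterate `X`, the step size `η` and the
broadcast pair `(lamTilde, v)`. -/
def localUpdate {Na τ : ℕ} (K : ℕ) (L η : ℝ) (d : LocalData Na τ)
    (X : Matrix (Fin Na) (Fin τ) ℂ) (lamTilde : ℝ) (v : Fin τ → ℂ) :
    Matrix (Fin Na) (Fin τ) ℂ :=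
  clip L d.mask
    (((1 - η : ℝ) : ℂ) • X
      - ((η * K / lamTilde : ℝ) : ℂ) • (residual d X * Matrix.vecMulVec v (star v)))

/-- The step sizes `η⁽¹⁾ = 1` and `η⁽ⁿ⁾ = 1 / T` for `n ≥ 2`. -/
def stepSize (T n : ℕ) : ℝ := if n = 1 then 1 else 1 / T

/-- One iteration with step size `η` and noise matrices `G m`, for all access points: the CPU
computes `(lamHat, v)` from the sum of the received matrices and broadcasts
`lamTilde = lamHat + √μ (M τ)^{1/4}` and `v`. -/
def fwStep {M Na τ : ℕ} (K : ℕ) (L μ η : ℝ)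
    (cpu : Matrix (Fin τ) (Fin τ) ℂ → ℝ × (Fin τ → ℂ)) (Y : Fin M → LocalData Na τ)
    (G : Fin M → Matrix (Fin τ) (Fin τ) ℂ) (X : Fin M → Matrix (Fin Na) (Fin τ) ℂ) :
    Fin M → Matrix (Fin Na) (Fin τ) ℂ :=
  let W := ∑ m, noisyGram (Y m) (X m) (G m)
  let lamTilde := (cpu W).1 + Real.sqrt μ * ((M : ℝ) * τ) ^ (1 / 4 : ℝ)
  fun m => localUpdate K L η (Y m) (X m) lamTilde (cpu W).2

/-- The iterates `X⁽ⁿ⁾`, starting from `X⁽⁰⁾ = 0`; iteration `n + 1` uses the noise `G n`. -/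
def fwIterate {M Na τ T : ℕ} (K : ℕ) (L μ : ℝ)
    (cpu : Matrix (Fin τ) (Fin τ) ℂ → ℝ × (Fin τ → ℂ)) (Y : Fin M → LocalData Na τ)
    (G : Fin T → Fin M → Matrix (Fin τ) (Fin τ) ℂ) :
    (n : ℕ) → n ≤ T → Fin M → Matrix (Fin Na) (Fin τ) ℂ
  | 0, _ => 0
  | n + 1, h =>
      fwStep K L μ (stepSize T (n + 1)) cpu Y (G ⟨n, h⟩)
        (fwIterate K L μ cpu Y G n (Nat.le_of_succ_le h))

/-- The output `X⁽ᵀ⁾` of the Frank-Wolfe-based algorithm run with noise matrices `G`. -/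
def privateFW {M Na τ T : ℕ} (K : ℕ) (L μ : ℝ)
    (cpu : Matrix (Fin τ) (Fin τ) ℂ → ℝ × (Fin τ → ℂ)) (Y : Fin M → LocalData Na τ)
    (G : Fin T → Fin M → Matrix (Fin τ) (Fin τ) ℂ) : Fin M → Matrix (Fin Na) (Fin τ) ℂ :=
  fwIterate K L μ cpu Y G T le_rfl

end

end PrivateFW

namespace PrivateFW

open scoped ENNReal NNReal

/-! The argument is Rényi differential privacy, with Rényi divergence in its dual form, a Hölder
inequality between two laws. A density in `L^p` gives such a bound with its `L^p` norm as constant.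
The constants multiply over independent factors and, since all shifts are fixed once the past noise
is fixed, also along an adaptive run.

The access points `j ≠ m` learn about the data of `m` only through the sum that reaches the CPU. If
the Gram matrix of `m` changes by `D`, that sum is unchanged when each of the `M` noise matrices is
shifted by `D / M` in compensation, so the other access points see identical broadcasts
(`fwStep_eq_of_shift`). Spreading the shift over all `M` matrices makes its cost exponent `(p - 1) /
2 * ‖D‖² / (M μ²)`, which is the source of the factor `1 / M` under the root in `μ`. Clipping bounds
every residual by `2 L`, hence `‖D‖ ≤ 8 L²` in Frobenius norm (`frobNorm_gramDiff_le`).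

Peeling off one iteration at a time (`lintegral_fwRun_le`) and applying the result to an indicator
gives, for the probabilities `P`, `P'` of an event under the two data sets, `P ≤ C ^ T * P' ^ (1 /
q)`. With `a = log (2.5 T / δ)`, `b = log (2 / δ)` and order `p = 1 + 4 a b / ε`, the total cost `C
^ T` is `exp (ε / 2)`. Weighted AM-GM turns the power of `P'` into `exp ε * P'` plus a remainder
(`exp_half_mul_rpow_le`), which is at most `δ` (`half_sub_le_log`). -/

/-- `P` is dominated by `Q` in the sense of a Hölder inequality: `∫ h dP ≤ C ‖h‖_{L^q(Q)}`. By
duality this bounds the Rényi divergence of `P` from `Q` of the order conjugate to `q`. -/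
def HolderDominated {X : Type*} [MeasurableSpace X] (q : ℝ) (C : ℝ≥0∞) (P Q : Measure X) : Prop :=
  ∀ h : X → ℝ≥0∞, Measurable h → ∫⁻ x, h x ∂P ≤ C * (∫⁻ x, h x ^ q ∂Q) ^ (1 / q)

/-! ### Calculus of Hölder domination -/

namespace HolderDominated

variable {X Y : Type*} [MeasurableSpace X] [MeasurableSpace Y] {q : ℝ} {C D : ℝ≥0∞}

theorem mono {P Q : Measure X} (h : HolderDominated q C P Q) (hCD : C ≤ D) :
    HolderDominated q D P Q :=
  fun f hf => (h f hf).trans (by gcongr)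

theorem map {P Q : Measure X} (h : HolderDominated q C P Q) {f : X → Y} (hf : Measurable f) :
    HolderDominated q C (P.map f) (Q.map f) := by
  intro k hk
  rw [lintegral_map hk hf, lintegral_map (hk.pow_const q) hf]
  exact h _ (hk.comp hf)

theorem refl {p : ℝ} (hpq : p.HolderConjugate q) (P : Measure X) [IsProbabilityMeasure P] :
    HolderDominated q 1 P P := by
  intro h hh
  simpa using ENNReal.lintegral_mul_le_Lp_mul_Lq P hpq
    (f := fun _ => 1) aemeasurable_const hh.aemeasurable

/-- Fubini, then the inner bound, then the outer bound applied to the inner `L^q` norm: its `q`-th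
power cancels the root, so the constants multiply. -/
theorem prod (hq : 0 < q) {P₁ Q₁ : Measure X} {P₂ Q₂ : Measure Y} [SFinite P₂] [SFinite Q₂]
    (h₁ : HolderDominated q C P₁ Q₁) (h₂ : HolderDominated q D P₂ Q₂) :
    HolderDominated q (C * D) (P₁.prod P₂) (Q₁.prod Q₂) := by
  intro h hh
  rw [lintegral_prod _ hh.aemeasurable, lintegral_prod _ (hh.pow_const q).aemeasurable]
  have hk : Measurable fun x => (∫⁻ y, h (x, y) ^ q ∂Q₂) ^ (1 / q) :=
    ((hh.pow_const q).lintegral_prod_right').pow_const _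
  calc ∫⁻ x, ∫⁻ y, h (x, y) ∂P₂ ∂P₁
      ≤ ∫⁻ x, D * (∫⁻ y, h (x, y) ^ q ∂Q₂) ^ (1 / q) ∂P₁ :=
        lintegral_mono fun x => h₂ _ (hh.comp measurable_prodMk_left)
    _ = D * ∫⁻ x, (∫⁻ y, h (x, y) ^ q ∂Q₂) ^ (1 / q) ∂P₁ := lintegral_const_mul _ hk
    _ ≤ D * (C * (∫⁻ x, ((∫⁻ y, h (x, y) ^ q ∂Q₂) ^ (1 / q)) ^ q ∂Q₁) ^ (1 / q)) := by
        gcongr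
        exact h₁ _ hk
    _ = C * D * (∫⁻ x, ∫⁻ y, h (x, y) ^ q ∂Q₂ ∂Q₁) ^ (1 / q) := by
        simp only [← ENNReal.rpow_mul, one_div_mul_cancel hq.ne', ENNReal.rpow_one]
        ring

theorem pi {p : ℝ} (hpq : p.HolderConjugate q) {n : ℕ} {Z : Fin n → Type*}
    [∀ i, MeasurableSpace (Z i)] {P Q : ∀ i, Measure (Z i)} [∀ i, IsProbabilityMeasure (P i)]
    [∀ i, IsProbabilityMeasure (Q i)] {C : Fin n → ℝ≥0∞}
    (h : ∀ i, HolderDominated q (C i) (P i) (Q i)) :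
    HolderDominated q (∏ i, C i) (Measure.pi P) (Measure.pi Q) := by
  induction n with
  | zero =>
    have hPQ : Measure.pi P = Measure.pi Q := by
      rw [Measure.pi_of_empty, Measure.pi_of_empty]
    rw [hPQ]
    simpa using refl hpq (Measure.pi Q)
  | succ n ih =>
    have hP := (measurePreserving_piFinSuccAbove P 0).symm
    have hQ := (measurePreserving_piFinSuccAbove Q 0).symm
    rw [← hP.map_eq, ← hQ.map_eq, Fin.prod_univ_succ]
    refine map ?_ (MeasurableEquiv.measurable _)
    exact prod hpq.symm.pos (h 0) (ih fun i => h _)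

end HolderDominated

/-! ### Cost of shifting Gaussian noise -/

/-- Shifting a real Gaussian by `s` costs the factor `exp ((p - 1) s² / (2 v))`. -/
theorem holderDominated_gaussianReal {p q : ℝ} (hpq : p.HolderConjugate q) (s : ℝ) (v : ℝ≥0)
    (hv : v = 0 → s = 0) :
    HolderDominated q (ENNReal.ofReal (Real.exp ((p - 1) / 2 * (s ^ 2 / v))))
      (gaussianReal s v) (gaussianReal 0 v) := by
  -- A Gaussian of variance zero is a Dirac mass; there the shift vanishes and `s ^ 2 / v` reads as
  -- `0`, so the constant is `1`.
  by_cases hv0 : v = 0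
  · rw [hv hv0]
    simpa using HolderDominated.refl hpq (gaussianReal 0 v)
  intro h hh
  have hvR : (v : ℝ) ≠ 0 := by exact_mod_cast hv0
  -- The density of `N(s, v)` with respect to `N(0, v)`. Its `p`-th moment is a value of the
  -- Gaussian moment generating function, and Hölder's inequality finishes.
  set f : ℝ → ℝ≥0∞ := fun x => ENNReal.ofReal (Real.exp (s / v * x - s ^ 2 / (2 * v))) with hf
  have hfm : Measurable f := by fun_prop
  have hdens : ∫⁻ x, h x ∂(gaussianReal s v) = ∫⁻ x, (f * h) x ∂(gaussianReal 0 v) := by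
    rw [gaussianReal_of_var_ne_zero _ hv0, gaussianReal_of_var_ne_zero _ hv0,
      lintegral_withDensity_eq_lintegral_mul _ (measurable_gaussianPDF _ _) hh,
      lintegral_withDensity_eq_lintegral_mul _ (measurable_gaussianPDF _ _) (hfm.mul hh)]
    refine lintegral_congr fun x => ?_
    simp only [Pi.mul_apply, ← mul_assoc]
    congr 1
    rw [gaussianPDF_def, gaussianPDF_def, hf]
    simp only
    rw [← ENNReal.ofReal_mul (gaussianPDFReal_nonneg _ _ _)]
    congr 1
    rw [gaussianPDFReal, gaussianPDFReal, mul_assoc _ (Real.exp _) (Real.exp _), ← Real.exp_add]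
    congr 2
    field_simp
    ring
  have hfp : ∫⁻ x, f x ^ p ∂(gaussianReal 0 v)
      = ENNReal.ofReal (Real.exp (p * ((p - 1) / 2 * (s ^ 2 / v)))) := by
    have hpow : ∀ x, f x ^ p
        = ENNReal.ofReal (Real.exp (-(p * s ^ 2 / (2 * v))) * Real.exp (p * s / v * x)) := by
      intro x
      rw [hf]
      simp only
      rw [ENNReal.ofReal_rpow_of_pos (Real.exp_pos _), ← Real.exp_mul, ← Real.exp_add]
      congr 2
      field_simp
      ring
    simp only [hpow]
    rw [← ofReal_integral_eq_lintegral_ofReal]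
    · rw [integral_const_mul]
      have := congrFun (mgf_id_gaussianReal (μ := 0) (v := v)) (p * s / v)
      simp only [mgf, id] at this
      rw [this, ← Real.exp_add]
      congr 2
      field_simp
      ring
    · exact (integrable_exp_mul_gaussianReal _).const_mul _
    · exact Filter.Eventually.of_forall fun x => by positivity
  rw [hdens]
  refine (ENNReal.lintegral_mul_le_Lp_mul_Lq _ hpq hfm.aemeasurable hh.aemeasurable).trans ?_
  rw [hfp, ENNReal.ofReal_rpow_of_pos (Real.exp_pos _), ← Real.exp_mul]
  have : p * ((p - 1) / 2 * (s ^ 2 / v)) * (1 / p) = (p - 1) / 2 * (s ^ 2 / v) := by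
    field_simp [hpq.ne_zero]
  rw [this]

theorem measurable_matrix_iff {X : Type*} [MeasurableSpace X] {a b : ℕ}
    {f : X → Matrix (Fin a) (Fin b) ℂ} :
    Measurable f ↔ ∀ i j, Measurable fun x => f x i j := by
  constructor
  · intro h i j
    exact (measurable_pi_apply j).comp ((measurable_pi_apply i).comp h)
  · intro h
    exact measurable_pi_lambda _ fun i => measurable_pi_lambda _ fun j => h i j

theorem measurable_hermitianOf {τ : ℕ} :
    Measurable (hermitianOf : (Fin τ → Fin τ → ℝ) → Matrix (Fin τ) (Fin τ) ℂ) := by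
  refine measurable_matrix_iff.2 fun i j => ?_
  simp only [hermitianOf, Matrix.of_apply]
  split_ifs <;> fun_prop

theorem measurable_add_const_matrix {a b : ℕ} (D : Matrix (Fin a) (Fin b) ℂ) :
    Measurable fun A : Matrix (Fin a) (Fin b) ℂ => A + D := by
  refine measurable_matrix_iff.2 fun i j => ?_
  exact (measurable_matrix_iff.1 measurable_id i j).add_const _

instance instIsProbabilityMeasureHermitianNoise (τ : ℕ) (μ : ℝ) :
    IsProbabilityMeasure (hermitianNoise τ μ) :=
  Measure.isProbabilityMeasure_map measurable_hermitianOf.aemeasurable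

instance instIsProbabilityMeasureNoiseLaw (T M τ : ℕ) (μ : ℝ) :
    IsProbabilityMeasure (noiseLaw T M τ μ) :=
  inferInstanceAs (IsProbabilityMeasure (Measure.pi _))

theorem frobNorm_nonneg {a b : ℕ} (A : Matrix (Fin a) (Fin b) ℂ) : 0 ≤ frobNorm A :=
  Real.sqrt_nonneg _

theorem frobNorm_sq {a b : ℕ} (A : Matrix (Fin a) (Fin b) ℂ) :
    frobNorm A ^ 2 = ∑ i, ∑ j, ‖A i j‖ ^ 2 :=
  Real.sq_sqrt (by positivity)

theorem eq_zero_of_frobNorm_eq_zero {a b : ℕ} {A : Matrix (Fin a) (Fin b) ℂ}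
    (h : frobNorm A = 0) : A = 0 := by
  have hs := frobNorm_sq A
  rw [h, zero_pow two_ne_zero, eq_comm,
    Finset.sum_eq_zero_iff_of_nonneg fun i _ => by positivity] at hs
  ext i j
  have hi := hs i (Finset.mem_univ _)
  rw [Finset.sum_eq_zero_iff_of_nonneg fun j _ => by positivity] at hi
  simpa using hi j (Finset.mem_univ _)

theorem frobNorm_smul {a b : ℕ} (c : ℂ) (A : Matrix (Fin a) (Fin b) ℂ) :
    frobNorm (c • A) = ‖c‖ * frobNorm A := by
  rw [← sq_eq_sq₀ (frobNorm_nonneg _) (mul_nonneg (norm_nonneg _) (frobNorm_nonneg _)), mul_pow,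
    frobNorm_sq, frobNorm_sq, Finset.mul_sum]
  refine Finset.sum_congr rfl fun i _ => ?_
  rw [Finset.mul_sum]
  refine Finset.sum_congr rfl fun j _ => ?_
  simp [mul_pow]

/-- The real coordinates of a Hermitian matrix in the parametrization `hermitianOf`. -/
def hermitianCoord {τ : ℕ} (D : Matrix (Fin τ) (Fin τ) ℂ) : Fin τ → Fin τ → ℝ := fun i j =>
  if i ≤ j then (D i j).re else (D j i).im

theorem hermitianOf_add_hermitianCoord {τ : ℕ} {D : Matrix (Fin τ) (Fin τ) ℂ}
    (hD : D.IsHermitian) (g : Fin τ → Fin τ → ℝ) :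
    hermitianOf (g + hermitianCoord D) = hermitianOf g + D := by
  ext i j
  have hij : star (D j i) = D i j := hD.apply i j
  simp only [hermitianOf, hermitianCoord, Matrix.of_apply, Matrix.add_apply, Pi.add_apply]
  rcases lt_trichotomy i j with h | rfl | h
  · simp only [h.ne, h, h.le, h.not_ge, if_true, if_false]
    apply Complex.ext <;> simp
  · have him : (D i i).im = 0 := by
      have := congrArg Complex.im hij
      simp at this
      linarith
    apply Complex.ext <;> simp [him]
  · simp only [h.ne', h.not_gt, h.le, h.not_ge, if_true, if_false]
    rw [← hij]
    apply Complex.ext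
    · simp
    · simp
      ring

/-- Each off-diagonal entry occurs twice in the Frobenius norm, and its two real coordinates have
variance `μ² / 2`. The two factors of two match, so the cost is exactly the squared Frobenius norm
over `μ²`. -/
theorem sum_hermitianCoord_sq_div {τ : ℕ} {D : Matrix (Fin τ) (Fin τ) ℂ} (hD : D.IsHermitian)
    (μ : ℝ) :
    ∑ i, ∑ j, hermitianCoord D i j ^ 2 /
        (((if i = j then (μ ^ 2).toNNReal else (μ ^ 2 / 2).toNNReal) : ℝ≥0) : ℝ)
      = frobNorm D ^ 2 / μ ^ 2 := by
  set d := hermitianCoord D with hd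
  have hent : ∀ i j, ‖D i j‖ ^ 2 = d i j ^ 2 + if i = j then 0 else d j i ^ 2 := by
    intro i j
    have hij : star (D j i) = D i j := hD.apply i j
    rw [← Complex.normSq_eq_norm_sq, Complex.normSq_apply]
    rcases lt_trichotomy i j with h | rfl | h
    · simp [hd, hermitianCoord, h.ne, h.le, h.not_ge, sq]
    · have him : (D i i).im = 0 := by
        have := congrArg Complex.im hij
        simp at this
        linarith
      simp [hd, hermitianCoord, him, sq]
    · rw [← hij]
      simp [hd, hermitianCoord, h.ne', h.le, h.not_ge, sq, add_comm]
  have hfrob : frobNorm D ^ 2 = ∑ i, ∑ j, (d i j ^ 2 + if i = j then 0 else d i j ^ 2) := by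
    rw [frobNorm_sq]
    simp only [hent, Finset.sum_add_distrib]
    congr 1
    rw [Finset.sum_comm]
    simp only [eq_comm]
  rw [hfrob, Finset.sum_div]
  refine Finset.sum_congr rfl fun i _ => ?_
  rw [Finset.sum_div]
  refine Finset.sum_congr rfl fun j _ => ?_
  split_ifs
  · rw [Real.coe_toNNReal _ (by positivity), add_zero]
  · rw [Real.coe_toNNReal _ (by positivity)]
    rcases eq_or_ne μ 0 with rfl | hμ
    · simp
    · field_simp
      ring

theorem prod_ofReal_exp {n : ℕ} (c : ℝ) (f : Fin n → ℝ) :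
    ∏ i, ENNReal.ofReal (Real.exp (c * f i)) = ENNReal.ofReal (Real.exp (c * ∑ i, f i)) := by
  rw [← ENNReal.ofReal_prod_of_nonneg fun i _ => (Real.exp_pos _).le, ← Real.exp_sum,
    Finset.mul_sum]

/-- Shifting the Hermitian Gaussian noise by `D` costs `exp ((p - 1) ‖D‖_F² / (2 μ²))`. -/
theorem holderDominated_hermitianNoise {p q : ℝ} (hpq : p.HolderConjugate q) {τ : ℕ} {μ : ℝ}
    {D : Matrix (Fin τ) (Fin τ) ℂ} (hD : D.IsHermitian) (hμ : μ = 0 → D = 0) :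
    HolderDominated q (ENNReal.ofReal (Real.exp ((p - 1) / 2 * (frobNorm D ^ 2 / μ ^ 2))))
      ((hermitianNoise τ μ).map (· + D)) (hermitianNoise τ μ) := by
  set d := hermitianCoord D with hd
  let v : Fin τ → Fin τ → ℝ≥0 := fun i j =>
    if i = j then (μ ^ 2).toNNReal else (μ ^ 2 / 2).toNNReal
  have hv : ∀ i j, v i j = 0 → d i j = 0 := by
    intro i j h
    have : μ = 0 := by
      by_contra hne
      have h2 : 0 < μ ^ 2 := by positivity
      simp only [v] at h
      split_ifs at h
      · exact (Real.toNNReal_pos.2 h2).ne' h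
      · exact (Real.toNNReal_pos.2 (half_pos h2)).ne' h
    simp [hd, hermitianCoord, hμ this]
  have hshift : (Measure.pi fun i => Measure.pi fun j => gaussianReal 0 (v i j)).map (· + d)
      = Measure.pi fun i => Measure.pi fun j => gaussianReal (d i j) (v i j) := by
    have hin : ∀ i, (Measure.pi fun j => gaussianReal 0 (v i j)).map (fun x j => x j + d i j)
        = Measure.pi fun j => gaussianReal (d i j) (v i j) := by
      intro i
      have := Measure.pi_map_pi (μ := fun j => gaussianReal 0 (v i j)) (f := fun j x => x + d i j)
        (hμ := fun j => by rw [gaussianReal_map_add_const]; infer_instance)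
        (fun j => by fun_prop)
      rw [this]
      simp only [gaussianReal_map_add_const, zero_add]
    have := Measure.pi_map_pi (μ := fun i => Measure.pi fun j => gaussianReal 0 (v i j))
      (f := fun i (x : Fin τ → ℝ) j => x j + d i j)
      (hμ := fun i => by rw [hin]; infer_instance) (fun i => Measurable.aemeasurable (by fun_prop))
    simp only [hin] at this
    exact this
  have hcoord : HolderDominated q
      (ENNReal.ofReal (Real.exp ((p - 1) / 2 * ∑ i, ∑ j, d i j ^ 2 / (v i j : ℝ))))
      (Measure.pi fun i => Measure.pi fun j => gaussianReal (d i j) (v i j))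
      (Measure.pi fun i => Measure.pi fun j => gaussianReal 0 (v i j)) := by
    rw [← prod_ofReal_exp]
    refine HolderDominated.pi hpq fun i => ?_
    rw [← prod_ofReal_exp]
    exact HolderDominated.pi hpq fun j => holderDominated_gaussianReal hpq _ _ (hv i j)
  rw [sum_hermitianCoord_sq_div hD, ← hshift] at hcoord
  have hmap := hcoord.map measurable_hermitianOf
  rw [Measure.map_map measurable_hermitianOf (measurable_add_const d)] at hmap
  have hcomp : hermitianOf ∘ (· + d) = (· + D) ∘ hermitianOf (τ := τ) :=
    funext fun g => hermitianOf_add_hermitianCoord hD g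
  rw [hcomp, ← Measure.map_map (measurable_add_const_matrix D) measurable_hermitianOf] at hmap
  exact hmap

/-- Shifting each of `M` independent noise matrices by `E`. -/
theorem holderDominated_pi_hermitianNoise {p q : ℝ} (hpq : p.HolderConjugate q) {M τ : ℕ} {μ : ℝ}
    {E : Matrix (Fin τ) (Fin τ) ℂ} (hE : E.IsHermitian) (hμ : μ = 0 → E = 0) :
    HolderDominated q (ENNReal.ofReal (Real.exp ((p - 1) / 2 * (M * (frobNorm E ^ 2 / μ ^ 2)))))
      ((Measure.pi fun _ : Fin M => hermitianNoise τ μ).map fun G j => G j + E)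
      (Measure.pi fun _ : Fin M => hermitianNoise τ μ) := by
  have hprob : IsProbabilityMeasure ((hermitianNoise τ μ).map (· + E)) :=
    Measure.isProbabilityMeasure_map (measurable_add_const_matrix E).aemeasurable
  have := Measure.pi_map_pi (μ := fun _ : Fin M => hermitianNoise τ μ)
    (f := fun _ G => G + E) (fun _ => (measurable_add_const_matrix E).aemeasurable)
  rw [this]
  have hsum : (M * (frobNorm E ^ 2 / μ ^ 2) : ℝ) = ∑ _i : Fin M, frobNorm E ^ 2 / μ ^ 2 := by
    simp
  rw [hsum, ← prod_ofReal_exp]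
  exact HolderDominated.pi hpq fun _ => holderDominated_hermitianNoise hpq hE hμ

/-! ### Sensitivity of the Gram matrix -/

section Sensitivity

attribute [local instance] Matrix.frobeniusNormedAddCommGroup

theorem frobNorm_eq_norm {a b : ℕ} (A : Matrix (Fin a) (Fin b) ℂ) : frobNorm A = ‖A‖ := by
  rw [Matrix.frobenius_norm_def, frobNorm, Real.sqrt_eq_rpow]
  simp

theorem frobNorm_sub_le {a b : ℕ} (A B : Matrix (Fin a) (Fin b) ℂ) :
    frobNorm (A - B) ≤ frobNorm A + frobNorm B := by
  simpa only [frobNorm_eq_norm] using norm_sub_le A B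

theorem frobNorm_conjTranspose_mul_self_le {a b : ℕ} (A : Matrix (Fin a) (Fin b) ℂ) :
    frobNorm (Aᴴ * A) ≤ frobNorm A ^ 2 := by
  simp only [frobNorm_eq_norm]
  refine (Matrix.frobenius_norm_mul _ _).trans ?_
  rw [Matrix.frobenius_norm_conjTranspose, sq]

end Sensitivity

theorem restrictTo_smul {a b : ℕ} (Ω : Finset (Fin a × Fin b)) (c : ℂ)
    (A : Matrix (Fin a) (Fin b) ℂ) : restrictTo Ω (c • A) = c • restrictTo Ω A := by
  ext i j
  simp [restrictTo]

theorem frobNorm_restrictTo_clip_le {a b : ℕ} {L : ℝ} (hL : 0 ≤ L) (Ω : Finset (Fin a × Fin b))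
    (A : Matrix (Fin a) (Fin b) ℂ) : frobNorm (restrictTo Ω (clip L Ω A)) ≤ L := by
  unfold clip
  split_ifs with h
  · exact h
  · have hpos : 0 < frobNorm (restrictTo Ω A) := hL.trans_lt (not_le.1 h)
    rw [restrictTo_smul, frobNorm_smul, Complex.norm_real, Real.norm_of_nonneg (by positivity),
      div_mul_cancel₀ _ hpos.ne']

variable {M Na τ : ℕ}

theorem frobNorm_residual_le {L : ℝ} {d : LocalData Na τ} (hd : d.IsPossible L)
    {X : Matrix (Fin Na) (Fin τ) ℂ} (hX : frobNorm (restrictTo d.mask X) ≤ L) :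
    frobNorm (residual d X) ≤ 2 * L := by
  have := frobNorm_sub_le (restrictTo d.mask X) d.signal
  have := hd.2
  unfold residual
  linarith

/-- The change of the Gram matrix of one access point between two runs. -/
def gramDiff (d d' : LocalData Na τ) (X X' : Matrix (Fin Na) (Fin τ) ℂ) :
    Matrix (Fin τ) (Fin τ) ℂ :=
  (residual d X)ᴴ * residual d X - (residual d' X')ᴴ * residual d' X'

theorem isHermitian_gramDiff (d d' : LocalData Na τ) (X X' : Matrix (Fin Na) (Fin τ) ℂ) :
    (gramDiff d d' X X').IsHermitian :=
  (Matrix.isHermitian_conjTranspose_mul_self _).sub (Matrix.isHermitian_conjTranspose_mul_self _)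

theorem frobNorm_gramDiff_le {L : ℝ} {d d' : LocalData Na τ} (hd : d.IsPossible L)
    (hd' : d'.IsPossible L) {X X' : Matrix (Fin Na) (Fin τ) ℂ}
    (hX : frobNorm (restrictTo d.mask X) ≤ L) (hX' : frobNorm (restrictTo d'.mask X') ≤ L) :
    frobNorm (gramDiff d d' X X') ≤ 8 * L ^ 2 := by
  have h₁ := frobNorm_conjTranspose_mul_self_le (residual d X)
  have h₂ := frobNorm_conjTranspose_mul_self_le (residual d' X')
  have h₃ := pow_le_pow_left₀ (frobNorm_nonneg _) (frobNorm_residual_le hd hX) 2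
  have h₄ := pow_le_pow_left₀ (frobNorm_nonneg _) (frobNorm_residual_le hd' hX') 2
  have h₅ := frobNorm_sub_le ((residual d X)ᴴ * residual d X) ((residual d' X')ᴴ * residual d' X')
  unfold gramDiff
  linarith

/-! ### Measurability of the iteration -/

section Measurability

variable {Z : Type*} [MeasurableSpace Z]

theorem measurable_matrix_apply {a b : ℕ} {f : Z → Matrix (Fin a) (Fin b) ℂ} (hf : Measurable f)
    (i : Fin a) (j : Fin b) : Measurable fun z => f z i j :=
  measurable_matrix_iff.1 hf i j

theorem measurable_restrictTo {a b : ℕ} (Ω : Finset (Fin a × Fin b))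
    {f : Z → Matrix (Fin a) (Fin b) ℂ} (hf : Measurable f) :
    Measurable fun z => restrictTo Ω (f z) := by
  refine measurable_matrix_iff.2 fun i j => ?_
  simp only [restrictTo, Matrix.of_apply]
  split_ifs
  · exact measurable_matrix_apply hf i j
  · exact measurable_const

theorem measurable_frobNorm {a b : ℕ} {f : Z → Matrix (Fin a) (Fin b) ℂ} (hf : Measurable f) :
    Measurable fun z => frobNorm (f z) := by
  have := measurable_matrix_apply hf
  unfold frobNorm
  fun_prop

theorem measurable_matrix_smul {a b : ℕ} {c : Z → ℂ} (hc : Measurable c)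
    {f : Z → Matrix (Fin a) (Fin b) ℂ} (hf : Measurable f) : Measurable fun z => c z • f z := by
  refine measurable_matrix_iff.2 fun i j => ?_
  simp only [Matrix.smul_apply, smul_eq_mul]
  exact hc.mul (measurable_matrix_apply hf i j)

theorem measurable_matrix_sub {a b : ℕ} {f g : Z → Matrix (Fin a) (Fin b) ℂ} (hf : Measurable f)
    (hg : Measurable g) : Measurable fun z => f z - g z :=
  measurable_matrix_iff.2 fun i j =>
    (measurable_matrix_apply hf i j).sub (measurable_matrix_apply hg i j)

theorem measurable_matrix_add {a b : ℕ} {f g : Z → Matrix (Fin a) (Fin b) ℂ} (hf : Measurable f)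
    (hg : Measurable g) : Measurable fun z => f z + g z :=
  measurable_matrix_iff.2 fun i j =>
    (measurable_matrix_apply hf i j).add (measurable_matrix_apply hg i j)

theorem measurable_matrix_sum {a b n : ℕ} {f : Fin n → Z → Matrix (Fin a) (Fin b) ℂ}
    (hf : ∀ k, Measurable (f k)) : Measurable fun z => ∑ k, f k z := by
  refine measurable_matrix_iff.2 fun i j => ?_
  simp only [Matrix.sum_apply]
  exact Finset.measurable_sum _ fun k _ => measurable_matrix_apply (hf k) i j

theorem measurable_matrix_mul {a b c : ℕ} {f : Z → Matrix (Fin a) (Fin b) ℂ}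
    {g : Z → Matrix (Fin b) (Fin c) ℂ} (hf : Measurable f) (hg : Measurable g) :
    Measurable fun z => f z * g z := by
  refine measurable_matrix_iff.2 fun i j => ?_
  simp only [Matrix.mul_apply]
  exact Finset.measurable_sum _ fun k _ =>
    (measurable_matrix_apply hf i k).mul (measurable_matrix_apply hg k j)

theorem measurable_matrix_conjTranspose {a b : ℕ} {f : Z → Matrix (Fin a) (Fin b) ℂ}
    (hf : Measurable f) : Measurable fun z => (f z)ᴴ := by
  refine measurable_matrix_iff.2 fun i j => ?_
  simp only [Matrix.conjTranspose_apply]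
  exact continuous_star.measurable.comp (measurable_matrix_apply hf j i)

theorem measurable_clip {a b : ℕ} (L : ℝ) (Ω : Finset (Fin a × Fin b))
    {f : Z → Matrix (Fin a) (Fin b) ℂ} (hf : Measurable f) :
    Measurable fun z => clip L Ω (f z) := by
  have hn := measurable_frobNorm (measurable_restrictTo Ω hf)
  unfold clip
  refine Measurable.ite (measurableSet_le hn measurable_const) hf ?_
  exact measurable_matrix_smul (Complex.measurable_ofReal.comp (hn.const_div L)) hf

theorem measurable_residual (d : LocalData Na τ) {f : Z → Matrix (Fin Na) (Fin τ) ℂ}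
    (hf : Measurable f) : Measurable fun z => residual d (f z) :=
  measurable_matrix_sub (measurable_restrictTo _ hf) measurable_const

theorem measurable_localUpdate (K : ℕ) (L η : ℝ) (d : LocalData Na τ)
    {f : Z → Matrix (Fin Na) (Fin τ) ℂ} (hf : Measurable f) {l : Z → ℝ} (hl : Measurable l)
    {v : Z → Fin τ → ℂ} (hv : Measurable v) :
    Measurable fun z => localUpdate K L η d (f z) (l z) (v z) := by
  have hvv : Measurable fun z => Matrix.vecMulVec (v z) (star (v z)) := by
    refine measurable_matrix_iff.2 fun i j => ?_
    simp only [Matrix.vecMulVec_apply, Pi.star_apply]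
    exact ((measurable_pi_apply i).comp hv).mul
      (continuous_star.measurable.comp ((measurable_pi_apply j).comp hv))
  refine measurable_clip _ _ (measurable_matrix_sub (measurable_matrix_smul measurable_const hf) ?_)
  exact measurable_matrix_smul (Complex.measurable_ofReal.comp (hl.const_div _))
    (measurable_matrix_mul (measurable_residual d hf) hvv)

theorem measurable_fwStep (K : ℕ) (L μ η : ℝ)
    {cpu : Matrix (Fin τ) (Fin τ) ℂ → ℝ × (Fin τ → ℂ)} (hcpu : Measurable cpu)
    (Y : Fin M → LocalData Na τ) {G : Z → Fin M → Matrix (Fin τ) (Fin τ) ℂ} (hG : Measurable G)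
    {X : Z → Fin M → Matrix (Fin Na) (Fin τ) ℂ} (hX : Measurable X) :
    Measurable fun z => fwStep K L μ η cpu Y (G z) (X z) := by
  have hXm : ∀ m, Measurable fun z => X z m := fun m => (measurable_pi_apply m).comp hX
  have hGm : ∀ m, Measurable fun z => G z m := fun m => (measurable_pi_apply m).comp hG
  have hW : Measurable fun z => cpu (∑ m, noisyGram (Y m) (X z m) (G z m)) :=
    hcpu.comp <| measurable_matrix_sum fun m => measurable_matrix_add
      (measurable_matrix_mul (measurable_matrix_conjTranspose (measurable_residual _ (hXm m)))
        (measurable_residual _ (hXm m))) (hGm m)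
  exact measurable_pi_lambda _ fun m =>
    measurable_localUpdate K L η (Y m) (hXm m) (hW.fst.add_const _) hW.snd

end Measurability

/-! ### Coupling of two runs and adaptive composition -/

/-- `n` iterations with step sizes `η` and noise matrices `G`, started at `X`. -/
noncomputable def fwRun (K : ℕ) (L μ : ℝ) (cpu : Matrix (Fin τ) (Fin τ) ℂ → ℝ × (Fin τ → ℂ))
    (Y : Fin M → LocalData Na τ) :
    (n : ℕ) → (Fin n → ℝ) → (Fin n → Fin M → Matrix (Fin τ) (Fin τ) ℂ) →
      (Fin M → Matrix (Fin Na) (Fin τ) ℂ) → Fin M → Matrix (Fin Na) (Fin τ) ℂ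
  | 0, _, _, X => X
  | n + 1, η, G, X =>
      fwRun K L μ cpu Y n (fun i => η i.succ) (fun i => G i.succ) (fwStep K L μ (η 0) cpu Y (G 0) X)

variable {K : ℕ} {L μ : ℝ} {cpu : Matrix (Fin τ) (Fin τ) ℂ → ℝ × (Fin τ → ℂ)}

/-- `fwRun` unrolls from the first iteration, as conditioning on the first noise requires, whereas
`fwIterate` unrolls from the last. This identity reconciles them. -/
theorem fwRun_succ_last (Y : Fin M → LocalData Na τ) {n : ℕ} (η : Fin (n + 1) → ℝ)
    (G : Fin (n + 1) → Fin M → Matrix (Fin τ) (Fin τ) ℂ) (X : Fin M → Matrix (Fin Na) (Fin τ) ℂ) :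
    fwRun K L μ cpu Y (n + 1) η G X = fwStep K L μ (η (Fin.last n)) cpu Y (G (Fin.last n))
      (fwRun K L μ cpu Y n (fun i => η i.castSucc) (fun i => G i.castSucc) X) := by
  induction n generalizing X with
  | zero => rfl
  | succ n ih =>
    rw [fwRun, ih]
    rfl

theorem fwIterate_eq_fwRun {T : ℕ} (Y : Fin M → LocalData Na τ)
    (G : Fin T → Fin M → Matrix (Fin τ) (Fin τ) ℂ) (n : ℕ) (hn : n ≤ T) :
    fwIterate K L μ cpu Y G n hn =
      fwRun K L μ cpu Y n (fun i => stepSize T (i + 1)) (fun i => G (i.castLE hn)) 0 := by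
  induction n with
  | zero => rfl
  | succ n ih =>
    rw [fwRun_succ_last, fwIterate, ih]
    rfl

theorem measurable_fwRun {Z : Type*} [MeasurableSpace Z] (hcpu : Measurable cpu)
    (Y : Fin M → LocalData Na τ) {n : ℕ} (η : Fin n → ℝ)
    {G : Z → Fin n → Fin M → Matrix (Fin τ) (Fin τ) ℂ} (hG : Measurable G)
    {X : Z → Fin M → Matrix (Fin Na) (Fin τ) ℂ} (hX : Measurable X) :
    Measurable fun z => fwRun K L μ cpu Y n η (G z) (X z) := by
  induction n generalizing X with
  | zero => exact hX
  | succ n ih =>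
    have hGi : ∀ i, Measurable fun z => G z i := fun i => (measurable_pi_apply i).comp hG
    exact ih _ (measurable_pi_lambda _ fun i => hGi i.succ)
      (measurable_fwStep K L μ _ hcpu Y (hGi 0) hX)

theorem lintegral_noiseLaw_succ {n : ℕ}
    {F : (Fin (n + 1) → Fin M → Matrix (Fin τ) (Fin τ) ℂ) → ℝ≥0∞}
    (hF : Measurable F) :
    ∫⁻ G, F G ∂(noiseLaw (n + 1) M τ μ) =
      ∫⁻ g, ∫⁻ G, F (Fin.cons g G) ∂(noiseLaw n M τ μ)
        ∂(Measure.pi fun _ : Fin M => hermitianNoise τ μ) := by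
  have hP := (measurePreserving_piFinSuccAbove
    (fun _ : Fin (n + 1) => Measure.pi fun _ : Fin M => hermitianNoise τ μ) 0).symm
  have := hP.lintegral_comp_emb (MeasurableEquiv.measurableEmbedding _) F
  rw [noiseLaw, ← this]
  refine (lintegral_prod (μ := Measure.pi fun _ : Fin M => hermitianNoise τ μ)
    (ν := noiseLaw n M τ μ) _ (hF.comp hP.measurable).aemeasurable).trans ?_
  refine lintegral_congr fun g => lintegral_congr fun G => congrArg F ?_
  exact Fin.insertNth_zero' g G

/-- The `M` shifts by `D / M` add up to `D`, exactly the amount by which the two noiseless Gram sums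
differ. The CPU therefore receives the same matrix in both runs, and access points other than `m`
update identically. The iterates of `m` itself may differ. -/
theorem fwStep_eq_of_shift {m : Fin M} {Y Y' : Fin M → LocalData Na τ}
    (hY : ∀ j, j ≠ m → Y j = Y' j) {X X' : Fin M → Matrix (Fin Na) (Fin τ) ℂ}
    (hX : ∀ j, j ≠ m → X j = X' j) (η : ℝ) (g : Fin M → Matrix (Fin τ) (Fin τ) ℂ) (j : Fin M)
    (hj : j ≠ m) :
    fwStep K L μ η cpu Y g X j = fwStep K L μ η cpu Y'
      (fun i => g i + (M : ℂ)⁻¹ • gramDiff (Y m) (Y' m) (X m) (X' m)) X' j := by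
  have hM : (M : ℂ) ≠ 0 := by exact_mod_cast m.pos.ne'
  have hW : ∑ i, noisyGram (Y i) (X i) (g i) = ∑ i, noisyGram (Y' i) (X' i)
      (g i + (M : ℂ)⁻¹ • gramDiff (Y m) (Y' m) (X m) (X' m)) := by
    simp only [noisyGram, ← add_assoc]
    rw [Finset.sum_add_distrib (g := fun _ => (M : ℂ)⁻¹ • gramDiff (Y m) (Y' m) (X m) (X' m)),
      Finset.sum_const, Finset.card_univ, Fintype.card_fin, ← Nat.cast_smul_eq_nsmul ℂ, smul_smul,
      mul_inv_cancel₀ hM, one_smul, Finset.sum_add_distrib, Finset.sum_add_distrib,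
      ← Finset.add_sum_erase _ (fun i => (residual (Y i) (X i))ᴴ * _) (Finset.mem_univ m),
      ← Finset.add_sum_erase _ (fun i => (residual (Y' i) (X' i))ᴴ * _) (Finset.mem_univ m)]
    have hrest : ∑ i ∈ Finset.univ.erase m, (residual (Y i) (X i))ᴴ * residual (Y i) (X i)
        = ∑ i ∈ Finset.univ.erase m, (residual (Y' i) (X' i))ᴴ * residual (Y' i) (X' i) :=
      Finset.sum_congr rfl fun i hi => by
        rw [hY i (Finset.ne_of_mem_erase hi), hX i (Finset.ne_of_mem_erase hi)]
    rw [hrest, gramDiff]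
    abel
  simp only [fwStep]
  rw [hW, hY j hj, hX j hj]

/-- Adaptive composition: if shifting the noise of one iteration by the largest possible change
of the Gram matrix costs at most `C`, then `n` iterations cost at most `C ^ n`. -/
theorem lintegral_fwRun_le {q : ℝ} (hq : 0 < q) {C : ℝ≥0∞} (hL : 0 ≤ L)
    (hcpu : Measurable cpu) {m : Fin M} {Y Y' : Fin M → LocalData Na τ}
    (hYm : (Y m).IsPossible L) (hYm' : (Y' m).IsPossible L) (hY : ∀ j, j ≠ m → Y j = Y' j)
    (hC : ∀ D : Matrix (Fin τ) (Fin τ) ℂ, D.IsHermitian → frobNorm D ≤ 8 * L ^ 2 →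
      HolderDominated q C
        ((Measure.pi fun _ : Fin M => hermitianNoise τ μ).map fun G j => G j + (M : ℂ)⁻¹ • D)
        (Measure.pi fun _ : Fin M => hermitianNoise τ μ))
    {h : ({j : Fin M // j ≠ m} → Matrix (Fin Na) (Fin τ) ℂ) → ℝ≥0∞} (hh : Measurable h)
    (n : ℕ) (η : Fin n → ℝ) (X X' : Fin M → Matrix (Fin Na) (Fin τ) ℂ)
    (hX : ∀ j, j ≠ m → X j = X' j) (hXm : frobNorm (restrictTo (Y m).mask (X m)) ≤ L)
    (hXm' : frobNorm (restrictTo (Y' m).mask (X' m)) ≤ L) :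
    ∫⁻ G, h (fun j => fwRun K L μ cpu Y n η G X j) ∂(noiseLaw n M τ μ) ≤
      C ^ n *
        (∫⁻ G, h (fun j => fwRun K L μ cpu Y' n η G X' j) ^ q ∂(noiseLaw n M τ μ)) ^ (1 / q) := by
  induction n generalizing X X' with
  | zero =>
    have hXX : (fun j : {j : Fin M // j ≠ m} => X j) = fun j : {j : Fin M // j ≠ m} => X' j :=
      funext fun j => hX j j.2
    simp [fwRun, hXX, ← ENNReal.rpow_mul, hq.ne']
  | succ n ih =>
    have hproj : Measurable fun (x : Fin M → Matrix (Fin Na) (Fin τ) ℂ)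
        (j : {j : Fin M // j ≠ m}) => x j := by fun_prop
    have hF : ∀ (Y : Fin M → LocalData Na τ) X,
        Measurable fun G => h fun j => fwRun K L μ cpu Y (n + 1) η G X j := fun Y X =>
      hh.comp (hproj.comp (measurable_fwRun hcpu Y η measurable_id measurable_const))
    rw [lintegral_noiseLaw_succ (hF Y X), lintegral_noiseLaw_succ ((hF Y' X').pow_const q)]
    set γ := Measure.pi fun _ : Fin M => hermitianNoise τ μ with hγ
    set D := gramDiff (Y m) (Y' m) (X m) (X' m) with hD
    let k : (Fin M → Matrix (Fin τ) (Fin τ) ℂ) → ℝ≥0∞ := fun g =>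
      (∫⁻ G, h (fun j => fwRun K L μ cpu Y' n (fun i => η i.succ) G
        (fwStep K L μ (η 0) cpu Y' g X') j) ^ q ∂(noiseLaw n M τ μ)) ^ (1 / q)
    have hk : Measurable k := by
      refine Measurable.pow_const (Measurable.lintegral_prod_right'
        (f := fun z : (Fin M → Matrix (Fin τ) (Fin τ) ℂ) ×
            (Fin n → Fin M → Matrix (Fin τ) (Fin τ) ℂ) =>
          h (fun j => fwRun K L μ cpu Y' n (fun i => η i.succ) z.2
            (fwStep K L μ (η 0) cpu Y' z.1 X') j) ^ q) ?_) _
      exact (hh.comp (hproj.comp (measurable_fwRun hcpu Y' _ measurable_snd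
        (measurable_fwStep K L μ _ hcpu Y' measurable_fst measurable_const)))).pow_const q
    have hshift : Measurable fun (G : Fin M → Matrix (Fin τ) (Fin τ) ℂ) j => G j + (M : ℂ)⁻¹ • D :=
      measurable_pi_lambda _ fun j =>
        (measurable_add_const_matrix _).comp (measurable_pi_apply j)
    calc ∫⁻ g, ∫⁻ G, h (fun j => fwRun K L μ cpu Y (n + 1) η (Fin.cons g G) X j)
            ∂(noiseLaw n M τ μ) ∂γ
        ≤ ∫⁻ g, C ^ n * k (fun j => g j + (M : ℂ)⁻¹ • D) ∂γ := by
          -- First-step noise `g` of one run is paired with the shifted noise of the other. As `X`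
          -- and `X'` are fixed, `D` does not depend on `g`; the new iterates agree off `m` and are
          -- clipped at `m`, so induction applies.
          refine lintegral_mono fun g => ?_
          exact ih _ _ _ (fwStep_eq_of_shift hY hX (η 0) g)
            (frobNorm_restrictTo_clip_le hL _ _) (frobNorm_restrictTo_clip_le hL _ _)
      _ = C ^ n * ∫⁻ g, k g ∂(γ.map fun G j => G j + (M : ℂ)⁻¹ • D) := by
          rw [lintegral_map hk hshift]
          exact lintegral_const_mul _ (hk.comp hshift)
      _ ≤ C ^ n * (C * (∫⁻ g, k g ^ q ∂γ) ^ (1 / q)) := by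
          gcongr
          exact hC D (isHermitian_gramDiff _ _ _ _) (frobNorm_gramDiff_le hYm hYm' hXm hXm') k hk
      -- `k ^ q` undoes the root in `k`, and the iterated integral is again one over all noise.
      _ = _ := by
          simp only [k, ← ENNReal.rpow_mul, one_div_mul_cancel hq.ne', ENNReal.rpow_one]
          rw [pow_succ, mul_assoc]
          rfl

/-! ### Calibration and conversion to `(ε, δ)` -/

/-- Weighted AM-GM with weights `l / (l + 1)` and `1 / (l + 1)`; the second term is chosen so that
the geometric mean is the left side. The weights are then bounded by `1`. -/
theorem exp_half_mul_rpow_le {x l : ℝ} (hx : 0 ≤ x) (hl : 0 < l) (ε : ℝ) :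
    Real.exp (ε / 2) * x ^ (l / (l + 1)) ≤ Real.exp ε * x + Real.exp (ε / 2 - l * ε / 2) := by
  have hl1 : 0 < l + 1 := by positivity
  have hsum : l / (l + 1) + 1 / (l + 1) = 1 := by field_simp
  have hw : 0 ≤ l / (l + 1) := by positivity
  have hw' : 0 ≤ 1 / (l + 1) := by positivity
  have key := Real.geom_mean_le_arith_mean2_weighted hw hw'
    (mul_nonneg (Real.exp_pos ε).le hx) (Real.exp_pos (ε / 2 - l * ε / 2)).le hsum
  have heq : (Real.exp ε * x) ^ (l / (l + 1)) * Real.exp (ε / 2 - l * ε / 2) ^ (1 / (l + 1))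
      = Real.exp (ε / 2) * x ^ (l / (l + 1)) := by
    rw [Real.mul_rpow (Real.exp_pos ε).le hx, ← Real.exp_mul, ← Real.exp_mul, mul_right_comm,
      ← Real.exp_add]
    congr 2
    field_simp
    ring
  rw [heq] at key
  refine key.trans (add_le_add ?_ ?_)
  · exact mul_le_of_le_one_left (mul_nonneg (Real.exp_pos ε).le hx) (by linarith)
  · exact mul_le_of_le_one_left (Real.exp_pos _).le (by linarith)

theorem noiseLevel_sq {M T : ℕ} {L ε δ : ℝ} (ha : 0 ≤ Real.log (2.5 * T / δ))
    (hb : 0 ≤ Real.log (2 / δ)) :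
    noiseLevel M T L ε δ ^ 2 =
      256 * L ^ 4 * ((T : ℝ) / M * Real.log (2.5 * T / δ) * Real.log (2 / δ)) / ε ^ 2 := by
  rw [noiseLevel, div_pow, mul_pow, Real.sq_sqrt (by positivity)]
  ring

/-- The cost of one iteration with the calibrated noise level. -/
theorem holderDominated_of_noiseLevel {p q : ℝ} (hpq : p.HolderConjugate q) {M T τ : ℕ}
    (hM : 0 < M) (hT : 0 < T) {L ε δ : ℝ} (hε : 0 < ε) (ha : 0 < Real.log (2.5 * T / δ))
    (hb : 0 < Real.log (2 / δ)) {D : Matrix (Fin τ) (Fin τ) ℂ} (hD : D.IsHermitian)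
    (hDL : frobNorm D ≤ 8 * L ^ 2) :
    HolderDominated q
      (ENNReal.ofReal (Real.exp ((p - 1) / 2 *
        (ε ^ 2 / (4 * Real.log (2.5 * T / δ) * Real.log (2 / δ) * T)))))
      ((Measure.pi fun _ : Fin M => hermitianNoise τ (noiseLevel M T L ε δ)).map
        fun G j => G j + (M : ℂ)⁻¹ • D)
      (Measure.pi fun _ : Fin M => hermitianNoise τ (noiseLevel M T L ε δ)) := by
  have hsq := noiseLevel_sq (M := M) (L := L) (ε := ε) ha.le hb.le
  set μ := noiseLevel M T L ε δ
  set a := Real.log (2.5 * T / δ)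
  set b := Real.log (2 / δ)
  have hM' : (0 : ℝ) < M := by exact_mod_cast hM
  have hT' : (0 : ℝ) < T := by exact_mod_cast hT
  -- With `L = 0` the noise is degenerate, but the sensitivity bound leaves nothing to hide.
  have hD0 : L = 0 → D = 0 := by
    rintro rfl
    exact eq_zero_of_frobNorm_eq_zero (le_antisymm (by simpa using hDL) (frobNorm_nonneg _))
  have hE : ((M : ℂ)⁻¹ • D).IsHermitian := by
    unfold Matrix.IsHermitian
    rw [Matrix.conjTranspose_smul, hD.eq]
    simp
  have hμ : μ = 0 → (M : ℂ)⁻¹ • D = 0 := by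
    intro h0
    have hL : L = 0 := by
      by_contra hL
      have : 0 < μ ^ 2 := by rw [hsq]; positivity
      simp [h0] at this
    rw [hD0 hL, smul_zero]
  refine (holderDominated_pi_hermitianNoise hpq hE hμ).mono
    (ENNReal.ofReal_le_ofReal (Real.exp_le_exp.2 ?_))
  refine mul_le_mul_of_nonneg_left ?_ (by linarith [hpq.lt])
  have hnorm : frobNorm ((M : ℂ)⁻¹ • D) = frobNorm D / M := by
    rw [frobNorm_smul]
    simp
    ring
  rw [hnorm]
  rcases eq_or_ne L 0 with hL | hL
  · simp [hD0 hL, frobNorm]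
    positivity
  · have hDsq := pow_le_pow_left₀ (frobNorm_nonneg D) hDL 2
    calc M * ((frobNorm D / M) ^ 2 / μ ^ 2) ≤ M * ((8 * L ^ 2) ^ 2 / M ^ 2 / μ ^ 2) := by
          rw [div_pow]
          gcongr
      -- The `4` is `256 / 64`: `256 L⁴` comes from `μ²` and `64 L⁴` from the squared sensitivity.
      _ = ε ^ 2 / (4 * a * b * T) := by
          rw [hsq]
          field_simp
          norm_num

/-- Since `log (2.5 T / δ) ≥ log (2 / δ) = log 2 + |log δ|`, the subtracted product is at least `2
(log 2)² + 4 log 2 |log δ|`, which exceeds `1 / 2 + |log δ|`. -/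
theorem half_sub_le_log {T : ℕ} (hT : 0 < T) {ε δ : ℝ} (hε1 : ε ≤ 1) (hδ : 0 < δ) (hδ1 : δ < 1) :
    ε / 2 - 2 * Real.log (2.5 * T / δ) * Real.log (2 / δ) ≤ Real.log δ := by
  have hT' : (1 : ℝ) ≤ T := by exact_mod_cast hT
  have hab : Real.log (2 / δ) ≤ Real.log (2.5 * T / δ) := by
    apply Real.log_le_log (by positivity)
    gcongr
    linarith
  have hb : Real.log (2 / δ) = Real.log 2 - Real.log δ := Real.log_div two_ne_zero hδ.ne'
  have hlogδ : Real.log δ < 0 := Real.log_neg hδ hδ1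
  have hlog2 := Real.log_two_gt_d9
  nlinarith

theorem isJointDP_privateFW (M Na τ K T : ℕ) (hT : 0 < T) (L ε δ : ℝ) (hε : 0 < ε) (hε1 : ε ≤ 1)
    (hδ : 0 < δ) (cpu : Matrix (Fin τ) (Fin τ) ℂ → ℝ × (Fin τ → ℂ)) (hcpu : Measurable cpu) :
    IsJointDP (noiseLaw T M τ (noiseLevel M T L ε δ))
      (privateFW (M := M) (Na := Na) (τ := τ) (T := T) K L (noiseLevel M T L ε δ) cpu)
      (LocalData.IsPossible L) ε δ := by
  intro m Y Y' hY hY' hYY' S hS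
  -- For `δ ≥ 1` the bound is trivial; for `δ < 1` both logarithms are positive.
  rcases le_or_gt 1 δ with hδ1 | hδ1
  · refine prob_le_one.trans (le_add_left ?_)
    rwa [ENNReal.one_le_ofReal]
  have hL : 0 ≤ L := (frobNorm_nonneg _).trans (hY m).2
  have hT' : (1 : ℝ) ≤ T := by exact_mod_cast hT
  have hb : 0 < Real.log (2 / δ) := Real.log_pos (by rw [lt_div_iff₀ hδ]; linarith)
  have ha : 0 < Real.log (2.5 * T / δ) := Real.log_pos (by rw [lt_div_iff₀ hδ]; linarith)
  have hlog := half_sub_le_log hT hε1 hδ hδ1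
  -- The Rényi order is chosen so that `T` iterations cost exactly `exp (ε / 2)`, leaving the other
  -- half of `ε` for the AM-GM conversion.
  have hC := fun D hD hDL => holderDominated_of_noiseLevel (M := M) (τ := τ) (L := L) (D := D)
    (p := 4 * Real.log (2.5 * T / δ) * Real.log (2 / δ) / ε + 1)
    (Real.HolderConjugate.conjExponent (lt_add_of_pos_left 1 (by positivity)))
    m.pos hT hε ha hb hD hDL
  set μ := noiseLevel M T L ε δ
  set a := Real.log (2.5 * T / δ)
  set b := Real.log (2 / δ)
  set l := 4 * a * b / ε with hl
  have hlpos : 0 < l := by positivity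
  have hconj : 1 / Real.conjExponent (l + 1) = l / (l + 1) := by
    rw [Real.conjExponent, add_sub_cancel_right, one_div_div]
  have hqpos : 0 < Real.conjExponent (l + 1) := by
    rw [Real.conjExponent, add_sub_cancel_right]
    positivity
  set q := Real.conjExponent (l + 1)
  have hrestr : ∀ Ω : Finset (Fin Na × Fin τ), frobNorm (restrictTo Ω 0) ≤ L := by
    intro Ω
    simpa [frobNorm, restrictTo] using hL
  let I : ({j : Fin M // j ≠ m} → Matrix (Fin Na) (Fin τ) ℂ) → ℝ≥0∞ := S.indicator 1
  have hind : Measurable I := measurable_one.indicator hS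
  have hrun := lintegral_fwRun_le (K := K) hqpos hL hcpu (hY m) (hY' m) hYY' hC hind T
    (fun i => stepSize T (i + 1)) 0 0 (fun _ _ => rfl) (hrestr _) (hrestr _)
  have hout : ∀ Y : Fin M → LocalData Na τ, Measurable fun G (j : {j : Fin M // j ≠ m}) =>
      fwRun K L μ cpu Y T (fun i => stepSize T (i + 1)) G 0 j := by
    intro Y
    have hproj : Measurable fun (x : Fin M → Matrix (Fin Na) (Fin τ) ℂ)
        (j : {j : Fin M // j ≠ m}) => x j := by fun_prop
    exact hproj.comp (measurable_fwRun hcpu Y _ measurable_id measurable_const)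
  have hfw : ∀ (Y : Fin M → LocalData Na τ) G, privateFW K L μ cpu Y G =
      fwRun K L μ cpu Y T (fun i => stepSize T (i + 1)) G 0 := fun Y G =>
    fwIterate_eq_fwRun Y G T le_rfl
  have hmeas : ∀ Y : Fin M → LocalData Na τ,
      ∫⁻ G, I (fun j => fwRun K L μ cpu Y T
        (fun i => stepSize T (i + 1)) G 0 j) ∂(noiseLaw T M τ μ) =
      noiseLaw T M τ μ {G | (fun j : {j : Fin M // j ≠ m} => privateFW K L μ cpu Y G j) ∈ S} := by
    intro Y
    simp only [hfw]
    exact lintegral_indicator_one (hout Y hS)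
  -- An indicator equals its own `q`-th power, so the composed bound involves only the probabilities
  -- of `S`.
  have hpow : ∀ x, I x ^ q = I x := by
    intro x
    by_cases hx : x ∈ S <;> simp [I, hx, hqpos]
  simp only [hpow, hmeas] at hrun
  refine hrun.trans ?_
  set Q := noiseLaw T M τ μ
    {G | (fun j : {j : Fin M // j ≠ m} => privateFW K L μ cpu Y' G j) ∈ S} with hQ
  have hQtop : Q ≠ ∞ := measure_ne_top _ _
  have hcost : (l + 1 - 1) / 2 * (ε ^ 2 / (4 * a * b * T)) * T = ε / 2 := by
    rw [hl]
    field_simp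
    ring
  rw [← ENNReal.ofReal_pow (Real.exp_pos _).le, ← Real.exp_nat_mul, mul_comm (T : ℝ), hcost, hconj,
    ← ENNReal.ofReal_toReal hQtop,
    ENNReal.ofReal_rpow_of_nonneg ENNReal.toReal_nonneg (by positivity),
    ← ENNReal.ofReal_mul (Real.exp_pos _).le, ← ENNReal.ofReal_mul (Real.exp_pos _).le,
    ← ENNReal.ofReal_add (by positivity) hδ.le]
  refine ENNReal.ofReal_le_ofReal ((exp_half_mul_rpow_le ENNReal.toReal_nonneg hlpos ε).trans ?_)
  gcongr
  rw [← Real.le_log_iff_exp_le hδ]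
  have : l * ε / 2 = 2 * a * b := by
    rw [hl]
    field_simp
    ring
  rwa [this]

end PrivateFW

theorem theorem1 (M Na τ K T : ℕ) (hT : 0 < T) (L ε δ : ℝ) (hε : 0 < ε) (hε1 : ε ≤ 1) (hδ : 0 < δ)
    (cpu : Matrix (Fin τ) (Fin τ) ℂ → ℝ × (Fin τ → ℂ)) (hcpu_meas : Measurable cpu)
    (hcpu : PrivateFW.IsTopEigenRule cpu) :
    PrivateFW.IsJointDP
      (PrivateFW.noiseLaw T M τ (PrivateFW.noiseLevel M T L ε δ))
      (PrivateFW.privateFW (M := M) (Na := Na) (τ := τ) (T := T) K L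
        (PrivateFW.noiseLevel M T L ε δ) cpu)
      (PrivateFW.LocalData.IsPossible L) ε δ := by
  exact PrivateFW.isJointDP_privateFW M Na τ K T hT L ε δ hε hε1 hδ cpu hcpu_meas
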